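/- Consider combinatorial auctions with $m$ items and $n$ bidders. A valuation is a function $v:2^{[m]}\to[0,\infty)$ with $v(\emptyset)=0$ and $v(S)\le v(T)$ whenever $S\subseteq T$; it is submodular if $v(S\cup T)\le v(S)+v(T)-v(S\cap T)$ for all $S,T\subseteq[m]$. An outcome consists of pairwise disjoint bundles $S_1,\dots,S_n\subseteq[m]$ and payments $p_1,\dots,p_n\ge 0$. A (deterministic) mechanism that communicates with the bidders only by value queries is an adaptive procedure which, at each step, either asks some bidder $i$ for the value $v_i(S)$ of some bundle $S$ (the choice depending only on the replies so far) or stops and outputs an outcome. It is truthful for submodular bidders if for every profile $(v_1,\dots,v_n)$ of submodular valuations no bidder $i$ can increase his utility $v_i(S_i)-p_i$ by reporting another submodular valuation instead of $v_i$. It has approximation ratio $\alpha$ w.r.t. submodular valuations if on every profile of submodular valuations its output satisfies $\sum_i v_i(S_i)\ge\frac1\alpha\sum_i v_i(T_i)$ for every allocation $(T_1,\dots,T_n)$. **Theorem.** For every $\epsilon>0$ there are constants $C>0$ and $m_0$, depending only on $\epsilon$, such that for all $m\ge m_0$ and all $n\ge C\,m^{\frac12-\epsilon}$ the following holds: every truthful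 mechanism for $n$ bidders and $m$ items that communicates with the bidders only by value queries and has an approximation ratio of $m^{\frac12-\epsilon}$ w.r.t. submodular valuations makes exponentially many value queries: there is a profile of submodular valuations on which it makes at least $2^{m^{\epsilon}}-1$ value queries. -/

import Mathlib

namespace CombAuction

/-- A (reported) valuation of bundles of the `m` items. -/
abbrev BundleFun (m : ℕ) : Type := Finset (Fin m) → ℝ

/-- Valuations: nonnegative, normalized and nondecreasing. -/
structure IsValuation {m : ℕ} (v : BundleFun m) : Prop where
  nonneg : ∀ S, 0 ≤ v S
  normalized : v ∅ = 0
  nondecreasing : ∀ S T, S ⊆ T → v S ≤ v T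

/-- The class of submodular valuations on `m` items. -/
def Submodular (m : ℕ) : Set (BundleFun m) :=
  {v | IsValuation v ∧ ∀ S T, v (S ∪ T) ≤ v S + v T - v (S ∩ T)}

/-- An allocation of `m` items to `n` bidders: pairwise disjoint bundles (items may stay unsold). -/
structure Allocation (n m : ℕ) where
  bundle : Fin n → Finset (Fin m)
  pairwise_disjoint : ∀ i j, i ≠ j → Disjoint (bundle i) (bundle j)

/-- Social welfare of an allocation. -/
noncomputable def Allocation.welfare {n m : ℕ} (A : Allocation n m) (v : Fin n → BundleFun m) : ℝ :=
  ∑ i, v i (A.bundle i)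

/-- What a mechanism outputs: an allocation and a nonnegative payment for each bidder. -/
structure Outcome (n m : ℕ) where
  alloc : Allocation n m
  pay : Fin n → NNReal

/-- Utility of bidder `i`, whose actual valuation is `u`, at a given outcome. -/
noncomputable def Outcome.utility {n m : ℕ} (o : Outcome n m) (i : Fin n) (u : BundleFun m) : ℝ :=
  u (o.alloc.bundle i) - (o.pay i : ℝ)

/-- A deterministic mechanism that accesses the bidders only through value queries, as an adaptive
decision tree: either it stops with an outcome, or it asks bidder `i` for the value of the bundle
`S` and continues according to the real number that is the reply. -/
inductive ValueQueryMechanism (n m : ℕ) : Type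
  | stop_with (o : Outcome n m) : ValueQueryMechanism n m
  | query (i : Fin n) (S : Finset (Fin m)) (next : ℝ → ValueQueryMechanism n m) :
      ValueQueryMechanism n m

namespace ValueQueryMechanism

variable {n m : ℕ}

/-- The outcome when the bidders answer the queries according to `v`. -/
noncomputable def run (v : Fin n → BundleFun m) : ValueQueryMechanism n m → Outcome n m
  | stop_with o => o
  | query i S next => run v (next (v i S))

/-- The number of value queries asked when the bidders answer according to `v`. -/
noncomputable def numQueries (v : Fin n → BundleFun m) : ValueQueryMechanism n m → ℕ
  | stop_with _ => 0
  | query i S next => numQueries v (next (v i S)) + 1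

/-- Truthfulness on the class `F`: whatever the other bidders report, reporting the actual
valuation maximizes a bidder's utility. -/
def IsTruthful (M : ValueQueryMechanism n m) (F : Set (BundleFun m)) : Prop :=
  ∀ v : Fin n → BundleFun m, (∀ j, v j ∈ F) → ∀ (i : Fin n), ∀ w ∈ F,
    (M.run (Function.update v i w)).utility i (v i) ≤ (M.run v).utility i (v i)

/-- Approximation ratio `α` on the class `F`: on every profile the welfare obtained is at least
a `1/α` fraction of the welfare of every allocation. -/
def HasApproxRatio (M : ValueQueryMechanism n m) (F : Set (BundleFun m)) (α : ℝ) : Prop :=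
  ∀ v : Fin n → BundleFun m, (∀ j, v j ∈ F) → ∀ A : Allocation n m,
    1 / α * A.welfare v ≤ (M.run v).alloc.welfare v

end ValueQueryMechanism

end CombAuction

/-! Fix the reports of all bidders but one. By truthfulness the remaining bidder picks a best entry
of a menu of priced bundles. Suppose the menu has many bundles of one size such that every menu
bundle strictly containing one of them costs more than each of them. Steep capped valuations single
out any such S by altering one value, that of S itself, so the mechanism must query all but one of
them (`card_le_numQueries`).

If an additive bidder who values every item at 1/m or more picks S, then strict supersets of S cost
at least 1/m more. Sorting bundles by size and by price in steps of 1/m thus bounds the menu reached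
by polar reports by poly(m) times the number of queries plus one (`card_polarMenu_le`).

Now let k bidders want independent random sets containing each item with probability 1/k, namely
zero sets of uniform words over `Fin k`. The expected optimum is at least m/2. A bidder's menu does
not depend on his own set, so by a Chernoff and a union bound he rarely gets more than h + 2|S|/k
wanted items in his bundle S, once h exceeds the logarithm of the menu size. The expected welfare is
then about kh + 2m/k (`tradeoff`), too little for ratio α = m^(1/2-ε) when k ≈ 16α and h is of order
m^(2ε). -/

namespace CombAuction

open Finset

variable {n m : ℕ}

/-! ### Capped valuations -/

/-- The valuation that is additive with slope `2 * D` on bundles of fewer than `s` items, and whose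
larger bundles have value `2 * D * s` if they are in `H` and approach this value geometrically in
their size if they are not. -/
noncomputable def cappedVal (s : ℕ) (D : ℝ) (H : Set (Finset (Fin m))) : BundleFun m := by
  classical
  exact fun T => if #T < s then 2 * D * #T
    else 2 * D * s - D * (if T ∈ H then 0 else (1 / 2) ^ (#T - s))

section cappedVal

variable {s : ℕ} {D : ℝ} {H : Set (Finset (Fin m))} {T : Finset (Fin m)}

theorem cappedVal_of_card_lt (h : #T < s) : cappedVal s D H T = 2 * D * #T := by
  simp [cappedVal, h]

theorem cappedVal_of_mem (h : s ≤ #T) (hT : T ∈ H) : cappedVal s D H T = 2 * D * s := by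
  simp [cappedVal, h.not_gt, hT]

theorem cappedVal_of_notMem (h : s ≤ #T) (hT : T ∉ H) :
    cappedVal s D H T = 2 * D * s - D * (1 / 2) ^ (#T - s) := by
  simp [cappedVal, h.not_gt, hT]

theorem cappedVal_congr {H' : Set (Finset (Fin m))} (h : T ∈ H ↔ T ∈ H') :
    cappedVal s D H T = cappedVal s D H' T := by
  by_cases h' : T ∈ H' <;> simp [cappedVal, h, h']

theorem cappedVal_le (hD : 0 ≤ D) : cappedVal s D H T ≤ 2 * D * s := by
  rcases lt_or_ge #T s with h | h
  · rw [cappedVal_of_card_lt h]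
    have : (#T : ℝ) ≤ s := by exact_mod_cast h.le
    gcongr
  · by_cases hT : T ∈ H
    · rw [cappedVal_of_mem h hT]
    · rw [cappedVal_of_notMem h hT]
      have : 0 ≤ D * (1 / 2) ^ (#T - s) := by positivity
      linarith

theorem cappedVal_le_card (hD : 0 ≤ D) : cappedVal s D H T ≤ 2 * D * #T := by
  rcases lt_or_ge #T s with h | h
  · rw [cappedVal_of_card_lt h]
  · refine (cappedVal_le hD).trans ?_
    have : (s : ℝ) ≤ #T := by exact_mod_cast h
    gcongr

theorem le_cappedVal (hD : 0 ≤ D) (h : s ≤ #T) :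
    2 * D * s - D * (1 / 2) ^ (#T - s) ≤ cappedVal s D H T := by
  by_cases hT : T ∈ H
  · rw [cappedVal_of_mem h hT]
    have : 0 ≤ D * (1 / 2) ^ (#T - s) := by positivity
    linarith
  · rw [cappedVal_of_notMem h hT]

theorem le_cappedVal' (hD : 0 ≤ D) (h : s ≤ #T) : 2 * D * s - D ≤ cappedVal s D H T := by
  refine le_trans ?_ (le_cappedVal hD h)
  have : ((1 : ℝ) / 2) ^ (#T - s) ≤ 1 := pow_le_one₀ (by norm_num) (by norm_num)
  nlinarith

theorem cappedVal_mono (hD : 0 ≤ D) (hH : IsUpperSet H) {S T : Finset (Fin m)} (hST : S ⊆ T) :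
    cappedVal s D H S ≤ cappedVal s D H T := by
  have hc := card_le_card hST
  rcases lt_or_ge #T s with hT | hT
  · rw [cappedVal_of_card_lt hT, cappedVal_of_card_lt (hc.trans_lt hT)]
    gcongr
  rcases lt_or_ge #S s with hS | hS
  · refine le_trans ?_ (le_cappedVal' hD hT)
    rw [cappedVal_of_card_lt hS]
    have : (#S : ℝ) + 1 ≤ s := by exact_mod_cast hS
    nlinarith
  by_cases h : S ∈ H
  · rw [cappedVal_of_mem hS h, cappedVal_of_mem hT (hH hST h)]
  · rw [cappedVal_of_notMem hS h]
    refine le_trans ?_ (le_cappedVal hD hT)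
    have : ((1 : ℝ) / 2) ^ (#T - s) ≤ (1 / 2) ^ (#S - s) :=
      pow_le_pow_of_le_one (by norm_num) (by norm_num) (by omega)
    nlinarith

/-- Consider the gap to the cap `2 * D * s`. Unless S and T both have fewer than `s` items, or are
nested, their gaps add up to at most the gap of S ∩ T: beyond size `s` each extra item at least
halves the gap, and before that it removes at least D. -/
theorem cappedVal_union_le (hD : 0 ≤ D) (hH : IsUpperSet H) (S T : Finset (Fin m)) :
    cappedVal s D H (S ∪ T) ≤ cappedVal s D H S + cappedVal s D H T - cappedVal s D H (S ∩ T) := by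
  wlog hST : #S ≤ #T generalizing S T
  · rw [union_comm, inter_comm, add_comm]
    exact this T S (by omega)
  by_cases h₁ : S ⊆ T
  · rw [union_eq_right.2 h₁, inter_eq_left.2 h₁]
    linarith
  have hIS : #(S ∩ T) < #S := card_lt_card ⟨inter_subset_left, fun h => h₁ (h.trans inter_subset_right)⟩
  have hsum := card_union_add_card_inter S T
  have hsum' : (#(S ∪ T) : ℝ) + #(S ∩ T) = #S + #T := by exact_mod_cast hsum
  rcases lt_or_ge #(S ∩ T) s with hI | hI
  · rw [cappedVal_of_card_lt hI]
    rcases lt_or_ge #S s with hS | hS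
    · rw [cappedVal_of_card_lt hS]
      rcases lt_or_ge #T s with hT | hT
      · rw [cappedVal_of_card_lt hT]
        have := cappedVal_le_card (s := s) (H := H) (T := S ∪ T) hD
        nlinarith
      · have h₂ := cappedVal_le (s := s) (H := H) (T := S ∪ T) hD
        have h₃ := le_cappedVal' (H := H) hD hT
        have h₄ : (#(S ∩ T) : ℝ) + 1 ≤ #S := by exact_mod_cast hIS
        nlinarith
    · have h₂ := cappedVal_le (s := s) (H := H) (T := S ∪ T) hD
      have h₃ := le_cappedVal' (H := H) hD hS
      have h₄ := le_cappedVal' (H := H) hD (hS.trans hST)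
      have h₅ : (#(S ∩ T) : ℝ) + 1 ≤ s := by exact_mod_cast hI
      nlinarith
  · have hU := cappedVal_le (s := s) (H := H) (T := S ∪ T) hD
    by_cases h : S ∩ T ∈ H
    · rw [cappedVal_of_mem hI h, cappedVal_of_mem (hI.trans hIS.le) (hH inter_subset_left h),
        cappedVal_of_mem (hI.trans (hIS.le.trans hST)) (hH inter_subset_right h)]
      linarith
    · rw [cappedVal_of_notMem hI h]
      have key : ∀ R : Finset (Fin m), #(S ∩ T) < #R →
          2 * D * s - D * (1 / 2) ^ (#(S ∩ T) - s) / 2 ≤ cappedVal s D H R := by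
        intro R hR
        refine le_trans ?_ (le_cappedVal hD (hI.trans hR.le))
        have : ((1 : ℝ) / 2) ^ (#R - s) ≤ (1 / 2) ^ (#(S ∩ T) - s + 1) :=
          pow_le_pow_of_le_one (by norm_num) (by norm_num) (by omega)
        rw [pow_succ] at this
        nlinarith
      have h₁ := key S hIS
      have h₂ := key T (hIS.trans_le hST)
      linarith

theorem cappedVal_mem_submodular (hs : 0 < s) (hD : 0 ≤ D) (hH : IsUpperSet H) :
    cappedVal s D H ∈ Submodular m := by
  have h0 : cappedVal s D H ∅ = 0 := by
    rw [cappedVal_of_card_lt (by simpa using hs)]; simp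
  refine ⟨⟨fun S => ?_, h0, fun S T => cappedVal_mono hD hH⟩, cappedVal_union_le hD hH⟩
  rw [← h0]
  exact cappedVal_mono hD hH (empty_subset S)

end cappedVal

/-! ### Menus and value queries -/

namespace ValueQueryMechanism

/-- The set of queries asked when the bidders answer according to `v`. -/
noncomputable def queries (v : Fin n → BundleFun m) :
    ValueQueryMechanism n m → Finset (Fin n × Finset (Fin m))
  | stop_with _ => ∅
  | query i S next => insert (i, S) (queries v (next (v i S)))

theorem card_queries_le (v : Fin n → BundleFun m) (M : ValueQueryMechanism n m) :
    #(M.queries v) ≤ M.numQueries v := by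
  induction M with
  | stop_with o => simp [queries]
  | query i S next ih =>
    simp only [queries, numQueries]
    exact (card_insert_le _ _).trans (Nat.add_le_add_right (ih _) 1)

theorem run_congr {v w : Fin n → BundleFun m} (M : ValueQueryMechanism n m)
    (h : ∀ q ∈ M.queries v, w q.1 q.2 = v q.1 q.2) : M.run w = M.run v := by
  induction M with
  | stop_with o => rfl
  | query i S next ih =>
    simp only [queries, mem_insert, forall_eq_or_imp] at h
    simp only [run]
    rw [h.1]
    exact ih _ h.2

/-- The outcome when bidder `i` reports `u` and the other bidders report `v`. -/
noncomputable def runWith (M : ValueQueryMechanism n m) (v : Fin n → BundleFun m) (i : Fin n)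
    (u : BundleFun m) : Outcome n m :=
  M.run (Function.update v i u)

/-- The bundle that bidder `i` gets when he reports `u` and the other bidders report `v`. -/
noncomputable def bundleOf (M : ValueQueryMechanism n m) (v : Fin n → BundleFun m) (i : Fin n)
    (u : BundleFun m) : Finset (Fin m) :=
  (M.runWith v i u).alloc.bundle i

/-- The payment of bidder `i` when he reports `u` and the other bidders report `v`. -/
noncomputable def payOf (M : ValueQueryMechanism n m) (v : Fin n → BundleFun m) (i : Fin n)
    (u : BundleFun m) : ℝ :=
  (M.runWith v i u).pay i

variable {M : ValueQueryMechanism n m} {v : Fin n → BundleFun m} {i : Fin n}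

theorem payOf_nonneg (u : BundleFun m) : 0 ≤ M.payOf v i u := NNReal.coe_nonneg _

theorem update_mem_class {F : Set (BundleFun m)} (hv : ∀ j, v j ∈ F) {u : BundleFun m}
    (hu : u ∈ F) (j : Fin n) : Function.update v i u j ∈ F := by
  rcases eq_or_ne j i with rfl | h
  · simpa using hu
  · simpa [h] using hv j

/-- The menu form of truthfulness: every report `w` is an available choice for a bidder with
valuation `u`. -/
theorem IsTruthful.utility_le {F : Set (BundleFun m)} (hM : M.IsTruthful F) (hv : ∀ j, v j ∈ F)
    {u w : BundleFun m} (hu : u ∈ F) (hw : w ∈ F) :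
    u (M.bundleOf v i w) - M.payOf v i w ≤ u (M.bundleOf v i u) - M.payOf v i u := by
  have h := hM (Function.update v i u) (update_mem_class hv hu) i w hw
  simpa [Outcome.utility, bundleOf, payOf, runWith] using h

/-- If bidder `i` reports the capped valuation for which `S` is the only bundle of its size with the
full value, then he gets `S`. -/
theorem IsTruthful.bundleOf_cappedVal (hM : M.IsTruthful (Submodular m))
    (hv : ∀ j, v j ∈ Submodular m) {s : ℕ} (hs : 0 < s) {D : ℝ} {𝓢 : Finset (Finset (Fin m))}
    {H : Set (Finset (Fin m))} {u : Finset (Fin m) → BundleFun m}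
    (hu : ∀ S ∈ 𝓢, u S ∈ Submodular m) (hb : ∀ S ∈ 𝓢, M.bundleOf v i (u S) = S)
    (hcard : ∀ S ∈ 𝓢, #S = s) {S : Finset (Fin m)} (hS : S ∈ 𝓢)
    (hD : M.payOf v i (u S) < D * (1 / 2) ^ m)
    (hH : ∀ T, T ∈ H ↔ T = S ∨ ∃ S' ∈ 𝓢, S' ⊂ T) (hHu : IsUpperSet H)
    (hprice : ∀ S' ∈ 𝓢, ∀ w ∈ Submodular m, S' ⊂ M.bundleOf v i w →
      M.payOf v i (u S) < M.payOf v i w) :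
    M.bundleOf v i (cappedVal s D H) = S := by
  have hp := payOf_nonneg (M := M) (v := v) (i := i) (u S)
  have hD0 : 0 < D := by
    by_contra! h
    have : D * (1 / 2) ^ m ≤ 0 := mul_nonpos_of_nonpos_of_nonneg h (by positivity)
    linarith
  have hF := cappedVal_mem_submodular (H := H) hs hD0.le hHu
  have hIC := hM.utility_le (i := i) hv hF (hu S hS)
  rw [hb S hS, cappedVal_of_mem (hcard S hS).ge ((hH S).2 (.inl rfl))] at hIC
  have hp' := payOf_nonneg (M := M) (v := v) (i := i) (cappedVal s D H)
  by_contra hne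
  have hpow : ∀ l ≤ m, D * (1 / 2) ^ m ≤ D * (1 / 2) ^ l := fun l hl =>
    mul_le_mul_of_nonneg_left (pow_le_pow_of_le_one (by norm_num) (by norm_num) hl) hD0.le
  have hm := hpow 0 (Nat.zero_le _)
  -- Compared with S, a smaller bundle loses at least 2D and one outside H at least D/2^m, both
  -- above the price of S; another bundle in H gains nothing and costs more.
  rcases lt_or_ge #(M.bundleOf v i (cappedVal s D H)) s with hT | hT
  · rw [cappedVal_of_card_lt hT] at hIC
    have : (#(M.bundleOf v i (cappedVal s D H)) : ℝ) + 1 ≤ s := by exact_mod_cast hT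
    nlinarith
  · by_cases h : M.bundleOf v i (cappedVal s D H) ∈ H
    · rw [cappedVal_of_mem hT h] at hIC
      obtain h | ⟨S', hS', hlt⟩ := (hH _).1 h
      · exact hne h
      · have := hprice S' hS' _ hF hlt
        linarith
    · rw [cappedVal_of_notMem hT h] at hIC
      have := hpow (#(M.bundleOf v i (cappedVal s D H)) - s)
        ((Nat.sub_le _ _).trans (card_finset_fin_le _))
      linarith

/-- A family of bundles of the same size in the menu of bidder `i`, such that every menu bundle
strictly containing one of them costs more than each of them, is at most one larger than the number
of queries asked on some submodular profile. -/
theorem IsTruthful.card_le_numQueries (hM : M.IsTruthful (Submodular m))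
    (hv : ∀ j, v j ∈ Submodular m) {s : ℕ} {𝓢 : Finset (Finset (Fin m))}
    {u : Finset (Fin m) → BundleFun m}
    (hu : ∀ S ∈ 𝓢, u S ∈ Submodular m) (hb : ∀ S ∈ 𝓢, M.bundleOf v i (u S) = S)
    (hcard : ∀ S ∈ 𝓢, #S = s)
    (hprice : ∀ S ∈ 𝓢, ∀ S' ∈ 𝓢, ∀ w ∈ Submodular m, S' ⊂ M.bundleOf v i w →
      M.payOf v i (u S) < M.payOf v i w) :
    ∃ v' : Fin n → BundleFun m, (∀ j, v' j ∈ Submodular m) ∧ #𝓢 ≤ M.numQueries v' + 1 := by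
  rcases Nat.eq_zero_or_pos s with rfl | hs
  · refine ⟨v, hv, ?_⟩
    have : #𝓢 ≤ 1 := card_le_one.2 fun S hS T hT => by
      rw [card_eq_zero.1 (hcard S hS), card_eq_zero.1 (hcard T hT)]
    omega
  -- Large enough that D/2^m exceeds every payment in the family.
  set D : ℝ := 2 ^ m * (1 + ∑ S ∈ 𝓢, M.payOf v i (u S)) with hDdef
  have hsum : 0 ≤ ∑ S ∈ 𝓢, M.payOf v i (u S) := sum_nonneg fun S _ => payOf_nonneg _
  have hD0 : 0 ≤ D := by positivity
  have hD : ∀ S ∈ 𝓢, M.payOf v i (u S) < D * (1 / 2) ^ m := by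
    intro S hS
    have h₁ : M.payOf v i (u S) ≤ ∑ S ∈ 𝓢, M.payOf v i (u S) :=
      single_le_sum (f := fun S => M.payOf v i (u S)) (fun S _ => payOf_nonneg _) hS
    have h₂ : D * (1 / 2) ^ m = 1 + ∑ S ∈ 𝓢, M.payOf v i (u S) := by
      rw [hDdef, mul_right_comm, ← mul_pow]; norm_num
    linarith
  let H₀ : Set (Finset (Fin m)) := {T | ∃ S' ∈ 𝓢, S' ⊂ T}
  have hH₀ : IsUpperSet H₀ := fun T T' h ⟨S', hS', hlt⟩ => ⟨S', hS', hlt.trans_le h⟩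
  let H : Finset (Fin m) → Set (Finset (Fin m)) := fun S => {T | T = S ∨ ∃ S' ∈ 𝓢, S' ⊂ T}
  have hH : ∀ S ∈ 𝓢, IsUpperSet (H S) := by
    rintro S hS T T' h (rfl | h')
    · rcases eq_or_lt_of_le h with rfl | h
      · exact .inl rfl
      · exact .inr ⟨T, hS, h⟩
    · exact .inr (hH₀ h h')
  set v₀ := Function.update v i (cappedVal s D H₀) with hv₀
  refine ⟨v₀, update_mem_class hv (cappedVal_mem_submodular hs hD0 hH₀), ?_⟩
  -- `H S` and `H₀` can differ only at S. If S is not queried, the run cannot tell them apart and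
  -- gives S to bidder i; this can happen for only one S.
  have hout : ∀ S ∈ 𝓢, (i, S) ∉ M.queries v₀ → S = (M.run v₀).alloc.bundle i := by
    intro S hS hq
    have h₁ := hM.bundleOf_cappedVal hv hs hu hb hcard hS (hD S hS) (fun T => Iff.rfl) (hH S hS)
      (hprice S hS)
    have h₂ : M.run (Function.update v i (cappedVal s D (H S))) = M.run v₀ := by
      refine M.run_congr fun q hq' => ?_
      rcases eq_or_ne q.1 i with hi | hi
      · have hne : q.2 ≠ S := by
          rintro rfl
          exact hq (by rw [← hi]; exact hq')
        rw [hv₀, hi, Function.update_self, Function.update_self]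
        exact cappedVal_congr ⟨fun h => h.resolve_left hne, .inr⟩
      · rw [hv₀, Function.update_of_ne hi, Function.update_of_ne hi]
    rw [← h₂]
    exact h₁.symm
  have hsub : 𝓢 ⊆ insert ((M.run v₀).alloc.bundle i) ((M.queries v₀).image Prod.snd) := by
    intro S hS
    by_cases hq : (i, S) ∈ M.queries v₀
    · exact mem_insert_of_mem (mem_image.2 ⟨_, hq, rfl⟩)
    · exact mem_insert.2 (.inl (hout S hS hq))
  calc #𝓢 ≤ #((M.queries v₀).image Prod.snd) + 1 := (card_le_card hsub).trans (card_insert_le _ _)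
    _ ≤ M.numQueries v₀ + 1 :=
      Nat.add_le_add_right (card_image_le.trans (card_queries_le _ _)) 1

end ValueQueryMechanism

/-! ### Polar valuations and their menus -/

/-- The additive valuation in which every item has value `1 / m`, and the items of `A` have an
additional value of `1`. -/
noncomputable def polarVal (A : Finset (Fin m)) : BundleFun m :=
  fun T => #(T ∩ A) + (#T : ℝ) / m

theorem polarVal_mono (A : Finset (Fin m)) {S T : Finset (Fin m)} (h : S ⊆ T) :
    polarVal A S ≤ polarVal A T := by
  unfold polarVal
  gcongr

theorem polarVal_mem_submodular (A : Finset (Fin m)) : polarVal A ∈ Submodular m := by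
  refine ⟨⟨fun S => by unfold polarVal; positivity, by simp [polarVal],
    fun S T => polarVal_mono A⟩, fun S T => ?_⟩
  have h₁ : (#(S ∪ T) : ℝ) + #(S ∩ T) = #S + #T := by exact_mod_cast card_union_add_card_inter S T
  have h₂ : (#((S ∪ T) ∩ A) : ℝ) + #(S ∩ T ∩ A) = #(S ∩ A) + #(T ∩ A) := by
    have := card_union_add_card_inter (S ∩ A) (T ∩ A)
    rw [← union_inter_distrib_right, ← inter_inter_distrib_right] at this
    exact_mod_cast this
  unfold polarVal
  have h₃ : (#(S ∪ T) : ℝ) / m = #S / m + #T / m - #(S ∩ T) / m := by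
    rw [← add_div, ← sub_div]; congr 1; linarith
  rw [h₃]
  linarith

theorem polarVal_le (A T : Finset (Fin m)) : polarVal A T ≤ #(T ∩ A) + 1 := by
  unfold polarVal
  have h : (#T : ℝ) ≤ m := by exact_mod_cast card_finset_fin_le T
  have := div_le_one_of_le₀ h (Nat.cast_nonneg _)
  linarith

theorem polarVal_le' (A T : Finset (Fin m)) : polarVal A T ≤ m + 1 := by
  refine (polarVal_le A T).trans ?_
  have h : (#(T ∩ A) : ℝ) ≤ m := by exact_mod_cast card_finset_fin_le _
  linarith

/-- This is what the term 1/m per item is for: it forces a price gap between a chosen bundle and its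
strict supersets in the menu. -/
theorem polarVal_add_le (A : Finset (Fin m)) {S T : Finset (Fin m)} (h : S ⊂ T) :
    polarVal A S + 1 / m ≤ polarVal A T := by
  unfold polarVal
  have h₁ : (#S : ℝ) + 1 ≤ #T := by exact_mod_cast card_lt_card h
  have h₂ : (#(S ∩ A) : ℝ) ≤ #(T ∩ A) := by
    exact_mod_cast card_le_card (inter_subset_inter_right h.subset)
  have h₃ : ((#S : ℝ) + 1) / m ≤ #T / m := by gcongr
  rw [add_div] at h₃
  linarith

namespace ValueQueryMechanism

variable {M : ValueQueryMechanism n m} {v : Fin n → BundleFun m} {i : Fin n}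

/-- The bundles that bidder `i` can get by reporting a polar valuation. -/
noncomputable def polarMenu (M : ValueQueryMechanism n m) (v : Fin n → BundleFun m) (i : Fin n) :
    Finset (Finset (Fin m)) :=
  univ.image fun A => M.bundleOf v i (polarVal A)

/-- A truthful mechanism with few queries offers few bundles to a bidder with a polar valuation. -/
theorem IsTruthful.card_polarMenu_le (hM : M.IsTruthful (Submodular m)) (hm : 0 < m)
    (hv : ∀ j, v j ∈ Submodular m) {L : ℕ}
    (hL : ∀ v' : Fin n → BundleFun m, (∀ j, v' j ∈ Submodular m) → M.numQueries v' + 1 ≤ L) :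
    #(M.polarMenu v i) ≤ 14 * m ^ 3 * L := by
  have hm' : (0 : ℝ) < m := by exact_mod_cast hm
  have hex : ∀ S : Finset (Fin m), ∃ A, S ∈ M.polarMenu v i → M.bundleOf v i (polarVal A) = S := by
    intro S
    by_cases h : S ∈ M.polarMenu v i
    · obtain ⟨A, -, hA⟩ := mem_image.1 h
      exact ⟨A, fun _ => hA⟩
    · exact ⟨∅, fun h' => absurd h' h⟩
  choose A hA using hex
  set p : Finset (Fin m) → ℝ := fun S => M.payOf v i (polarVal (A S)) with hp
  set p₀ := M.payOf v i (polarVal ∅) with hp₀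
  -- Neither the type ∅ nor the type `A S` gains by imitating the other, and both values lie between
  -- 0 and m + 1.
  have hrange : ∀ S, p₀ - (m + 1) ≤ p S ∧ p S ≤ p₀ + (m + 1) := by
    intro S
    have h₁ := hM.utility_le (i := i) hv (polarVal_mem_submodular (A S)) (polarVal_mem_submodular ∅)
    have h₂ := hM.utility_le (i := i) hv (polarVal_mem_submodular ∅) (polarVal_mem_submodular (A S))
    have h₃ := polarVal_le' (A S) (M.bundleOf v i (polarVal (A S)))
    have h₄ := polarVal_le' ∅ (M.bundleOf v i (polarVal (∅ : Finset (Fin m))))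
    have h₅ := (polarVal_mem_submodular (A S)).1.nonneg (M.bundleOf v i (polarVal ∅))
    have h₆ := (polarVal_mem_submodular (∅ : Finset (Fin m))).1.nonneg
      (M.bundleOf v i (polarVal (A S)))
    constructor <;> simp only [hp, hp₀] <;> linarith
  -- Bundles with equal keys have the same size and prices less than 1/m apart, so each class
  -- satisfies the hypotheses of `card_le_numQueries`.
  let key : Finset (Fin m) → ℕ × ℤ := fun S => (#S, ⌊p S * m⌋)
  set z : ℤ := ⌊p₀ * m⌋ with hz
  have himage : (M.polarMenu v i).image key ⊆
      range (m + 1) ×ˢ Icc (z - m * (m + 1)) (z + m * (m + 1)) := by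
    intro x hx
    obtain ⟨S, -, rfl⟩ := mem_image.1 hx
    obtain ⟨h₁, h₂⟩ := hrange S
    refine mem_product.2 ⟨mem_range.2 (Nat.lt_succ_of_le (card_finset_fin_le S)),
      mem_Icc.2 ⟨?_, ?_⟩⟩
    · have : p₀ * m - ((m * (m + 1) : ℤ) : ℝ) ≤ p S * m := by push_cast; nlinarith
      have := Int.floor_le_floor this
      rwa [Int.floor_sub_intCast] at this
    · have : p S * m ≤ p₀ * m + ((m * (m + 1) : ℤ) : ℝ) := by push_cast; nlinarith
      have := Int.floor_le_floor this
      rwa [Int.floor_add_intCast] at this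
  have hkeys : #((M.polarMenu v i).image key) ≤ 14 * m ^ 3 := by
    refine (card_le_card himage).trans ?_
    rw [card_product, card_range, Int.card_Icc]
    have : (z + m * (m + 1) + 1 - (z - m * (m + 1))).toNat = 2 * (m * (m + 1)) + 1 := by
      have : z + m * (m + 1) + 1 - (z - m * (m + 1)) = ((2 * (m * (m + 1)) + 1 : ℕ) : ℤ) := by
        push_cast; ring
      rw [this, Int.toNat_natCast]
    rw [this]
    have h₁ : 1 ≤ m ^ 2 := Nat.one_le_pow _ _ hm
    have h₂ : 1 ≤ m := hm
    calc (m + 1) * (2 * (m * (m + 1)) + 1) ≤ (m + m) * (2 * (m * (m + m)) + m ^ 2) := by gcongr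
      _ ≤ 14 * m ^ 3 := by nlinarith [Nat.zero_le (m ^ 3)]
  refine (card_le_mul_card_image (f := key) (M.polarMenu v i) L fun x _ => ?_).trans ?_
  · have hprice : ∀ S ∈ ({S ∈ M.polarMenu v i | key S = x} : Finset _),
        ∀ S' ∈ ({S ∈ M.polarMenu v i | key S = x} : Finset _), ∀ w ∈ Submodular m,
          S' ⊂ M.bundleOf v i w → p S < M.payOf v i w := by
      intro S hS S' hS' w hw hlt
      obtain ⟨hS, hSx⟩ := mem_filter.1 hS
      obtain ⟨hS', hSx'⟩ := mem_filter.1 hS'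
      have hfl : ⌊p S * m⌋ = ⌊p S' * m⌋ := congrArg Prod.snd (hSx.trans hSx'.symm)
      have habs := (abs_lt.1 (Int.abs_sub_lt_one_of_floor_eq_floor hfl)).2
      have hIC := hM.utility_le (i := i) hv (polarVal_mem_submodular (A S')) hw
      rw [hA S' hS'] at hIC
      have hadd := polarVal_add_le (A S') hlt
      have : p S < p S' + 1 / m := by
        rw [← sub_lt_iff_lt_add', lt_div_iff₀ hm', sub_mul]
        exact habs
      linarith
    obtain ⟨v', hv', hle⟩ := hM.card_le_numQueries (i := i) hv (s := x.1)
      (𝓢 := {S ∈ M.polarMenu v i | key S = x}) (u := fun S => polarVal (A S))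
      (fun S _ => polarVal_mem_submodular _) (fun S hS => hA S (mem_filter.1 hS).1)
      (fun S hS => congrArg Prod.fst (mem_filter.1 hS).2) hprice
    exact hle.trans (hL v' hv')
  · rw [mul_comm]
    exact Nat.mul_le_mul_right L hkeys

end ValueQueryMechanism

/-! ### Concentration for uniform random words -/

/-- The positions at which a word takes the value zero. -/
def zeroSet {k : ℕ} [NeZero k] (x : Fin m → Fin k) : Finset (Fin m) := {j | x j = 0}

section Counting

variable {k : ℕ} [NeZero k]

theorem mem_zeroSet {x : Fin m → Fin k} {j : Fin m} : j ∈ zeroSet x ↔ x j = 0 := by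
  simp [zeroSet]

/-- Coordinates are independent, so the mean of the left side is (1 + 1/k)^|S|. -/
theorem sum_two_pow_card_inter_zeroSet_le (S : Finset (Fin m)) :
    ∑ x : Fin m → Fin k, (2 : ℝ) ^ #(S ∩ zeroSet x) ≤ (k : ℝ) ^ m * Real.exp (#S / k) := by
  have hk : (0 : ℝ) < k := by exact_mod_cast Nat.pos_of_neZero k
  have h₁ : ∀ x : Fin m → Fin k, (2 : ℝ) ^ #(S ∩ zeroSet x) =
      ∏ j, if j ∈ S ∧ x j = 0 then (2 : ℝ) else 1 := by
    intro x
    rw [prod_ite, prod_const_one, mul_one, prod_const]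
    congr 2
    ext j
    simp [mem_zeroSet]
  have h₂ : ∀ j : Fin m, ∑ c : Fin k, (if j ∈ S ∧ c = 0 then (2 : ℝ) else 1) =
      k * if j ∈ S then 1 + 1 / (k : ℝ) else 1 := by
    intro j
    by_cases hj : j ∈ S
    · have : ∀ c : Fin k, (if c = 0 then (2 : ℝ) else 1) = 1 + if c = 0 then 1 else 0 := by
        intro c; split_ifs <;> norm_num
      simp only [hj, true_and, if_true, this, sum_add_distrib]
      simp
      field_simp
    · simp [hj]
  simp only [h₁]
  rw [← Fintype.piFinset_univ, ← prod_univ_sum (fun _ => univ)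
    (fun (j : Fin m) (c : Fin k) => if j ∈ S ∧ c = 0 then (2 : ℝ) else 1)]
  simp only [h₂]
  rw [prod_mul_distrib, prod_const, card_univ, Fintype.card_fin, prod_ite, prod_const_one, mul_one,
    prod_const, filter_mem_eq_inter, univ_inter]
  gcongr
  calc (1 + 1 / (k : ℝ)) ^ #S ≤ Real.exp (1 / k) ^ #S := by
        gcongr; linarith [Real.add_one_le_exp (1 / (k : ℝ))]
    _ = Real.exp (#S / k) := by rw [← Real.exp_nat_mul]; congr 1; ring

/-- The bundle `S` contains unusually many positions at which `x` takes the value zero. -/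
def IsLucky (h : ℝ) (x : Fin m → Fin k) (S : Finset (Fin m)) : Prop :=
  h + 2 * #S / k < #(S ∩ zeroSet x)

-- Markov's inequality for 2^|S ∩ zeroSet x|; the factor 2 in `IsLucky` absorbs e ≤ 2^2.
open Classical in
theorem card_isLucky_le (S : Finset (Fin m)) (h : ℝ) :
    (#{x : Fin m → Fin k | IsLucky h x S} : ℝ) ≤
      (k : ℝ) ^ m * (2 : ℝ) ^ (-h) := by
  have h₁ : (#{x : Fin m → Fin k | IsLucky h x S} : ℝ) *
      (2 : ℝ) ^ (h + 2 * #S / k) ≤ ∑ x : Fin m → Fin k, (2 : ℝ) ^ #(S ∩ zeroSet x) := by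
    rw [← nsmul_eq_mul, ← sum_const]
    refine (sum_le_sum fun x hx => ?_).trans
      (sum_le_sum_of_subset_of_nonneg (subset_univ _) fun _ _ _ => by positivity)
    rw [← Real.rpow_natCast]
    exact Real.rpow_le_rpow_of_exponent_le (by norm_num) (mem_filter.1 hx).2.le
  have h₂ : Real.exp (#S / k) ≤ (2 : ℝ) ^ (2 * #S / k : ℝ) := by
    rw [Real.rpow_def_of_pos (by norm_num), Real.exp_le_exp]
    have h₃ : (0 : ℝ) ≤ #S / k := by positivity
    rw [mul_div_assoc]
    nlinarith [Real.log_two_gt_d9]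
  have h₃ := h₁.trans ((sum_two_pow_card_inter_zeroSet_le S).trans
    (mul_le_mul_of_nonneg_left h₂ (by positivity)))
  rw [Real.rpow_add (by norm_num), ← mul_assoc] at h₃
  have h₄ := le_of_mul_le_mul_right h₃ (by positivity)
  rwa [Real.rpow_neg (by norm_num), ← div_eq_mul_inv, le_div_iff₀ (by positivity)]

theorem card_apply_ne_zero (j : Fin m) :
    (#{x : Fin m → Fin k | x j ≠ 0} : ℝ) = (k : ℝ) ^ m * (1 - 1 / k) := by
  have hk : (0 : ℝ) < k := by exact_mod_cast Nat.pos_of_neZero k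
  have h₁ : ({x : Fin m → Fin k | x j ≠ 0} : Finset (Fin m → Fin k)) =
      Fintype.piFinset fun l => if l = j then {0}ᶜ else univ := by
    ext x
    simp only [mem_filter, mem_univ, true_and, Fintype.mem_piFinset]
    constructor
    · intro h l
      split_ifs with hl
      · subst hl; simpa using h
      · simp
    · intro h
      simpa using h j
  have h₂ : ∀ l : Fin m, (#(if l = j then ({0}ᶜ : Finset (Fin k)) else univ) : ℝ) =
      k * if l = j then 1 - 1 / (k : ℝ) else 1 := by
    intro l
    split_ifs
    · rw [card_compl, Fintype.card_fin, card_singleton,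
        Nat.cast_sub (Nat.pos_of_neZero k)]
      field_simp
      simp
    · simp
  rw [h₁, Fintype.card_piFinset, Nat.cast_prod]
  simp only [h₂]
  rw [prod_mul_distrib, prod_const, card_univ, Fintype.card_fin, prod_ite_eq' univ j]
  simp

theorem card_forall_apply_ne_zero_le {I : Finset (Fin n)} (hI : #I = k) (j : Fin m) :
    (#{a : Fin n → Fin m → Fin k | ∀ i ∈ I, a i j ≠ 0} : ℝ) ≤ ((k : ℝ) ^ m) ^ n / 2 := by
  have hk : (1 : ℝ) ≤ k := by exact_mod_cast Nat.pos_of_neZero k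
  have h₁ : ({a : Fin n → Fin m → Fin k | ∀ i ∈ I, a i j ≠ 0} : Finset _) =
      Fintype.piFinset fun i =>
        if i ∈ I then ({x : Fin m → Fin k | x j ≠ 0} : Finset _) else univ := by
    ext a
    simp only [mem_filter, mem_univ, true_and, Fintype.mem_piFinset]
    refine forall_congr' fun i => ?_
    split_ifs with h <;> simp [h]
  have h₂ : ∀ i : Fin n,
      (#(if i ∈ I then ({x : Fin m → Fin k | x j ≠ 0} : Finset _) else univ) : ℝ) =
        (k : ℝ) ^ m * if i ∈ I then 1 - 1 / (k : ℝ) else 1 := by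
    intro i
    split_ifs
    · exact card_apply_ne_zero j
    · simp
  rw [h₁, Fintype.card_piFinset, Nat.cast_prod]
  simp only [h₂]
  rw [prod_mul_distrib, prod_const, card_univ, Fintype.card_fin, prod_ite, prod_const_one, mul_one,
    prod_const, filter_mem_eq_inter, univ_inter, hI, div_eq_mul_inv]
  refine mul_le_mul_of_nonneg_left ?_ (by positivity)
  refine (Real.one_sub_div_pow_le_exp_neg (n := k) hk).trans ?_
  rw [Real.exp_neg]
  exact inv_anti₀ (by norm_num) (by linarith [Real.add_one_le_exp (1 : ℝ)])

end Counting

/-- Resampling one coordinate preserves the uniform measure: swapping `a i` with the fresh `x` is an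
involution. It allows averaging over a bidder's type with his menu fixed. -/
theorem sum_mul_card_eq_sum_update {ι X : Type*} [Fintype ι] [DecidableEq ι] [Fintype X]
    (f : (ι → X) → ℝ) (i : ι) :
    (∑ a, f a) * Fintype.card X = ∑ a, ∑ x, f (Function.update a i x) := by
  have hinv : Function.Involutive fun p : (ι → X) × X => (Function.update p.1 i p.2, p.1 i) := by
    rintro ⟨a, x⟩
    simp
  calc (∑ a, f a) * Fintype.card X = ∑ p : (ι → X) × X, f p.1 := by
        rw [Fintype.sum_prod_type, sum_mul]
        simp [mul_comm]
    _ = ∑ p : (ι → X) × X, f (Function.update p.1 i p.2) :=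
        (Equiv.sum_comp hinv.toPerm fun p : (ι → X) × X => f p.1).symm
    _ = _ := Fintype.sum_prod_type _

/-! ### Welfare on random polar profiles -/

section Profile

variable {k : ℕ} [NeZero k] {I : Finset (Fin n)}

/-- The profile in which the bidders in `I` have the polar valuations described by `a`, and the
other bidders have the valuation zero. -/
noncomputable def polarProfile (I : Finset (Fin n)) (a : Fin n → Fin m → Fin k) :
    Fin n → BundleFun m :=
  fun i => if i ∈ I then polarVal (zeroSet (a i)) else 0

theorem zero_mem_submodular : (0 : BundleFun m) ∈ Submodular m := by
  refine ⟨⟨?_, ?_, ?_⟩, ?_⟩ <;> simp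

theorem polarProfile_mem (a : Fin n → Fin m → Fin k) (i : Fin n) :
    polarProfile I a i ∈ Submodular m := by
  unfold polarProfile
  split_ifs
  · exact polarVal_mem_submodular _
  · exact zero_mem_submodular

theorem polarProfile_update (a : Fin n → Fin m → Fin k) {i : Fin n} (hi : i ∈ I)
    (x : Fin m → Fin k) :
    polarProfile I (Function.update a i x) =
      Function.update (polarProfile I a) i (polarVal (zeroSet x)) := by
  ext1 j
  rcases eq_or_ne j i with rfl | h <;> simp [polarProfile, *]

theorem Allocation.sum_card_le (B : Allocation n m) (I : Finset (Fin n)) :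
    ∑ i ∈ I, #(B.bundle i) ≤ m := by
  rw [← card_biUnion fun i _ j _ h => B.pairwise_disjoint i j h]
  exact card_finset_fin_le _

theorem Allocation.welfare_polarProfile (B : Allocation n m) (a : Fin n → Fin m → Fin k) :
    B.welfare (polarProfile I a) = ∑ i ∈ I, polarVal (zeroSet (a i)) (B.bundle i) := by
  unfold welfare
  rw [← sum_subset (subset_univ I)]
  · exact sum_congr rfl fun i hi => by simp [polarProfile, hi]
  · intro i _ hi
    simp [polarProfile, hi]

-- Bundle sizes sum to at most m, so the bounds for bundles that are not lucky sum to the first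
-- three terms; a lucky bundle adds at most m.
open Classical in
theorem Allocation.welfare_polarProfile_le (hI : #I = k) (hm : 0 < m) {h : ℝ} (hh : 0 ≤ h)
    (B : Allocation n m) (a : Fin n → Fin m → Fin k) :
    B.welfare (polarProfile I a) ≤
      k * h + 2 * m / k + 1 + m * ∑ i ∈ I, if IsLucky h (a i) (B.bundle i) then (1 : ℝ) else 0 := by
  have hk : (0 : ℝ) < k := by exact_mod_cast Nat.pos_of_neZero k
  have hm' : (0 : ℝ) < m := by exact_mod_cast hm
  have hsum : (∑ i ∈ I, (#(B.bundle i) : ℝ)) ≤ m := by exact_mod_cast B.sum_card_le I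
  rw [B.welfare_polarProfile]
  calc ∑ i ∈ I, polarVal (zeroSet (a i)) (B.bundle i)
      ≤ ∑ i ∈ I, (h + #(B.bundle i) * (2 / k + 1 / m) +
          m * if IsLucky h (a i) (B.bundle i) then (1 : ℝ) else 0) := by
        refine sum_le_sum fun i _ => ?_
        unfold polarVal IsLucky
        have h₁ : (#(B.bundle i) : ℝ) * (2 / k + 1 / m) =
          2 * #(B.bundle i) / k + #(B.bundle i) / m := by ring
        rw [h₁]
        split_ifs with hl
        · have : (#(B.bundle i ∩ zeroSet (a i)) : ℝ) ≤ m := by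
            exact_mod_cast card_finset_fin_le _
          have : (0 : ℝ) ≤ 2 * #(B.bundle i) / k := by positivity
          linarith
        · linarith
    _ = k * h + (∑ i ∈ I, (#(B.bundle i) : ℝ)) * (2 / k + 1 / m) +
          m * ∑ i ∈ I, if IsLucky h (a i) (B.bundle i) then (1 : ℝ) else 0 := by
        rw [sum_add_distrib, sum_add_distrib, sum_const, hI, nsmul_eq_mul, ← sum_mul, ← mul_sum]
    _ ≤ k * h + m * (2 / k + 1 / m) +
          m * ∑ i ∈ I, if IsLucky h (a i) (B.bundle i) then (1 : ℝ) else 0 := by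
        gcongr
    _ = _ := by
        have : (m : ℝ) * (2 / k + 1 / m) = 2 * m / k + 1 := by field_simp
        rw [this]; ring

theorem exists_welfare_ge (a : Fin n → Fin m → Fin k) :
    ∃ B : Allocation n m, (#{j : Fin m | ∃ i ∈ I, a i j = 0} : ℝ) ≤
      B.welfare (polarProfile I a) := by
  classical
  rcases Nat.eq_zero_or_pos n with rfl | hn
  · refine ⟨⟨fun _ => ∅, by simp⟩, ?_⟩
    simp [Allocation.welfare]
  have : ∀ j : Fin m, ∃ i : Fin n, (∃ i ∈ I, a i j = 0) → i ∈ I ∧ a i j = 0 := by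
    intro j
    by_cases h : ∃ i ∈ I, a i j = 0
    · obtain ⟨i, hi⟩ := h
      exact ⟨i, fun _ => hi⟩
    · exact ⟨⟨0, hn⟩, fun h' => absurd h' h⟩
  choose g hg using this
  set U : Finset (Fin m) := {j : Fin m | ∃ i ∈ I, a i j = 0} with hU
  let B : Allocation n m := ⟨fun i => {j ∈ U | g j = i}, fun i i' hne =>
    disjoint_left.2 fun j hj hj' => hne ((mem_filter.1 hj).2.symm.trans (mem_filter.1 hj').2)⟩
  refine ⟨B, ?_⟩
  rw [B.welfare_polarProfile, card_eq_sum_card_fiberwise (f := g) (t := I)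
    fun j hj => (hg j (mem_filter.1 hj).2).1]
  push_cast
  refine sum_le_sum fun i _ => ?_
  have hB : B.bundle i = {j ∈ U | g j = i} := rfl
  have hsub : {j ∈ U | g j = i} ∩ zeroSet (a i) = {j ∈ U | g j = i} := by
    refine inter_eq_left.2 fun j hj => mem_zeroSet.2 ?_
    obtain ⟨hjU, rfl⟩ := mem_filter.1 hj
    exact (hg j (mem_filter.1 hjU).2).2
  rw [hB, polarVal, hsub]
  have : (0 : ℝ) ≤ #{j ∈ U | g j = i} / m := by positivity
  linarith

/-- Each item is unwanted by all k bidders with probability (1 - 1/k)^k ≤ 1/e ≤ 1/2. -/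
theorem sum_card_covered_ge (hI : #I = k) :
    m * (((k : ℝ) ^ m) ^ n / 2) ≤
      ∑ a : Fin n → Fin m → Fin k, (#{j : Fin m | ∃ i ∈ I, a i j = 0} : ℝ) := by
  have h₁ : ∀ a : Fin n → Fin m → Fin k, (#{j : Fin m | ∃ i ∈ I, a i j = 0} : ℝ) =
      ∑ j : Fin m, (1 - if ∀ i ∈ I, a i j ≠ 0 then (1 : ℝ) else 0) := by
    intro a
    rw [card_filter, Nat.cast_sum]
    refine sum_congr rfl fun j _ => ?_
    by_cases h : ∃ i ∈ I, a i j = 0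
    · have h' : ¬ ∀ i ∈ I, a i j ≠ 0 := by push Not; exact h
      rw [if_pos h, if_neg h']; simp
    · have h' : ∀ i ∈ I, a i j ≠ 0 := by push Not at h; exact h
      rw [if_neg h, if_pos h']; simp
  simp only [h₁]
  rw [sum_comm]
  have h₂ : ∀ j : Fin m, ((k : ℝ) ^ m) ^ n / 2 ≤
      ∑ a : Fin n → Fin m → Fin k, (1 - if ∀ i ∈ I, a i j ≠ 0 then (1 : ℝ) else 0) := by
    intro j
    have h₃ := card_forall_apply_ne_zero_le (n := n) hI j
    rw [sum_sub_distrib, sum_const, card_univ, Fintype.card_fun, Fintype.card_fun, Fintype.card_fin,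
      Fintype.card_fin, Fintype.card_fin, sum_boole, nsmul_eq_mul, mul_one]
    push_cast
    linarith
  calc m * (((k : ℝ) ^ m) ^ n / 2) = ∑ _j : Fin m, ((k : ℝ) ^ m) ^ n / 2 := by simp
    _ ≤ _ := sum_le_sum fun j _ => h₂ j

end Profile

/-! ### Averaging over random profiles -/

namespace ValueQueryMechanism

variable {M : ValueQueryMechanism n m} {k : ℕ} [NeZero k] {I : Finset (Fin n)}

theorem bundle_run_polarProfile_update (a : Fin n → Fin m → Fin k) {i : Fin n} (hi : i ∈ I)
    (x : Fin m → Fin k) :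
    (M.run (polarProfile I (Function.update a i x))).alloc.bundle i =
      M.bundleOf (polarProfile I a) i (polarVal (zeroSet x)) := by
  rw [polarProfile_update a hi]
  rfl

-- With the other types fixed, the bundle of bidder i lies in a menu that resampling `a i` leaves
-- unchanged; a union bound over it applies.
open Classical in
theorem sum_isLucky_le {N : ℝ} {h : ℝ} {i : Fin n} (hi : i ∈ I)
    (hN : ∀ a : Fin n → Fin m → Fin k, (#(M.polarMenu (polarProfile I a) i) : ℝ) ≤ N) :
    ∑ a : Fin n → Fin m → Fin k,
      (if IsLucky h (a i) ((M.run (polarProfile I a)).alloc.bundle i) then (1 : ℝ) else 0) ≤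
        ((k : ℝ) ^ m) ^ n * (N * (2 : ℝ) ^ (-h)) := by
  have hk : (0 : ℝ) < k := by exact_mod_cast Nat.pos_of_neZero k
  have hcard : (Fintype.card (Fin m → Fin k) : ℝ) = (k : ℝ) ^ m := by simp
  have h₁ := sum_mul_card_eq_sum_update (fun a : Fin n → Fin m → Fin k =>
    if IsLucky h (a i) ((M.run (polarProfile I a)).alloc.bundle i) then (1 : ℝ) else 0) i
  rw [hcard] at h₁
  refine le_of_mul_le_mul_right (h₁.trans_le ?_) (pow_pos hk m)
  simp only [bundle_run_polarProfile_update _ hi, Function.update_self]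
  have h₂ : ∀ a : Fin n → Fin m → Fin k, (∑ x : Fin m → Fin k,
      if IsLucky h x (M.bundleOf (polarProfile I a) i (polarVal (zeroSet x))) then (1 : ℝ) else 0) ≤
        N * ((k : ℝ) ^ m * (2 : ℝ) ^ (-h)) := by
    intro a
    rw [sum_boole]
    have hsub : ({x : Fin m → Fin k |
          IsLucky h x (M.bundleOf (polarProfile I a) i (polarVal (zeroSet x)))} : Finset _) ⊆
        (M.polarMenu (polarProfile I a) i).biUnion fun S =>
          {x : Fin m → Fin k | IsLucky h x S} := by
      intro x hx
      exact mem_biUnion.2 ⟨_, mem_image_of_mem _ (mem_univ _),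
        mem_filter.2 ⟨mem_univ _, (mem_filter.1 hx).2⟩⟩
    calc (#{x : Fin m → Fin k |
          IsLucky h x (M.bundleOf (polarProfile I a) i (polarVal (zeroSet x)))} : ℝ)
        ≤ ∑ S ∈ M.polarMenu (polarProfile I a) i, (#{x : Fin m → Fin k | IsLucky h x S} : ℝ) := by
          exact_mod_cast (card_le_card hsub).trans card_biUnion_le
      _ ≤ ∑ S ∈ M.polarMenu (polarProfile I a) i, (k : ℝ) ^ m * (2 : ℝ) ^ (-h) := by
          exact sum_le_sum fun S _ => card_isLucky_le S h
      _ ≤ N * ((k : ℝ) ^ m * (2 : ℝ) ^ (-h)) := by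
          rw [sum_const, nsmul_eq_mul]
          exact mul_le_mul_of_nonneg_right (hN a) (by positivity)
  refine (sum_le_sum fun a _ => h₂ a).trans (le_of_eq ?_)
  rw [sum_const, card_univ, Fintype.card_fun, Fintype.card_fun, Fintype.card_fin, Fintype.card_fin,
    Fintype.card_fin, nsmul_eq_mul]
  push_cast
  ring

/-- The tradeoff between the approximation ratio `α` of a truthful mechanism and its number of
queries, which is less than `L`. -/
theorem IsTruthful.tradeoff (hM : M.IsTruthful (Submodular m)) {α : ℝ} (hα : 0 < α)
    (happ : M.HasApproxRatio (Submodular m) α) (hm : 0 < m) (hI : #I = k) {L : ℕ}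
    (hL : ∀ v' : Fin n → BundleFun m, (∀ j, v' j ∈ Submodular m) → M.numQueries v' + 1 ≤ L)
    {h : ℝ} (hh : 0 ≤ h) :
    m / (2 * α) ≤
      k * h + 2 * m / k + 1 + m * (k * (14 * m ^ 3 * L * (2 : ℝ) ^ (-h))) := by
  classical
  have hk : (0 : ℝ) < k := by exact_mod_cast Nat.pos_of_neZero k
  have hW : (0 : ℝ) < ((k : ℝ) ^ m) ^ n := by positivity
  have hpt : ∀ a : Fin n → Fin m → Fin k,
      1 / α * (#{j : Fin m | ∃ i ∈ I, a i j = 0} : ℝ) ≤ k * h + 2 * m / k + 1 +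
        m * ∑ i ∈ I, if IsLucky h (a i) ((M.run (polarProfile I a)).alloc.bundle i)
          then (1 : ℝ) else 0 := by
    intro a
    obtain ⟨B, hB⟩ := exists_welfare_ge (I := I) a
    refine le_trans ?_ ((happ _ (polarProfile_mem a) B).trans
      ((M.run (polarProfile I a)).alloc.welfare_polarProfile_le hI hm hh a))
    gcongr
  have hsum := sum_le_sum fun a (_ : a ∈ (univ : Finset (Fin n → Fin m → Fin k))) => hpt a
  rw [← mul_sum, sum_add_distrib, sum_const, card_univ, Fintype.card_fun, Fintype.card_fun,
    Fintype.card_fin, Fintype.card_fin, Fintype.card_fin, nsmul_eq_mul, ← mul_sum, sum_comm] at hsum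
  push_cast at hsum
  have hlucky : ∑ i ∈ I, ∑ a : Fin n → Fin m → Fin k,
      (if IsLucky h (a i) ((M.run (polarProfile I a)).alloc.bundle i) then (1 : ℝ) else 0) ≤
        k * (((k : ℝ) ^ m) ^ n * (14 * m ^ 3 * L * (2 : ℝ) ^ (-h))) := by
    refine (sum_le_sum fun i hi => sum_isLucky_le (N := 14 * m ^ 3 * L) hi fun a => ?_).trans_eq ?_
    · exact_mod_cast hM.card_polarMenu_le hm (polarProfile_mem a) hL
    · rw [sum_const, hI, nsmul_eq_mul]
  have hcov := sum_card_covered_ge (m := m) hI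
  refine le_of_mul_le_mul_left ?_ hW
  calc ((k : ℝ) ^ m) ^ n * (m / (2 * α)) = 1 / α * (m * (((k : ℝ) ^ m) ^ n / 2)) := by
        field_simp
    _ ≤ _ := mul_le_mul_of_nonneg_left hcov (by positivity)
    _ ≤ _ := hsum
    _ ≤ _ := add_le_add_right (mul_le_mul_of_nonneg_left hlucky (Nat.cast_nonneg m)) _
    _ = _ := by ring

theorem cardVal_mem_submodular : (fun S => (#S : ℝ) : BundleFun m) ∈ Submodular m := by
  refine ⟨⟨fun S => Nat.cast_nonneg _, by simp, fun S T h => by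
    exact_mod_cast card_le_card h⟩, fun S T => ?_⟩
  have : (#(S ∪ T) : ℝ) + #(S ∩ T) = #S + #T := by exact_mod_cast card_union_add_card_inter S T
  linarith

/-- No allocation has welfare above m for the cardinality valuations. In the main theorem this
disposes of ε > 1/2. -/
theorem HasApproxRatio.one_le {α : ℝ} (happ : M.HasApproxRatio (Submodular m) α) (hα : 0 < α)
    (hm : 0 < m) (hn : 0 < n) : 1 ≤ α := by
  have hm' : (0 : ℝ) < m := by exact_mod_cast hm
  let B : Allocation n m := ⟨fun i => if i = ⟨0, hn⟩ then univ else ∅, fun i j hij => by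
    by_cases hi : i = ⟨0, hn⟩
    · have hj : j ≠ ⟨0, hn⟩ := fun hj => hij (hi.trans hj.symm)
      simp [hj]
    · simp [hi]⟩
  have h := happ (fun _ S => (#S : ℝ)) (fun _ => cardVal_mem_submodular) B
  have hB : B.welfare (fun _ S => (#S : ℝ)) = m := by
    simp [Allocation.welfare, B, apply_ite card, sum_ite_eq']
  have hrun := (M.run fun _ S => (#S : ℝ)).alloc.sum_card_le univ
  have hrun' : (M.run fun _ S => (#S : ℝ)).alloc.welfare (fun _ S => (#S : ℝ)) ≤ m := by
    simp only [Allocation.welfare]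
    exact_mod_cast hrun
  rw [hB] at h
  have h' := h.trans hrun'
  rw [div_mul_eq_mul_div, one_mul, div_le_iff₀ hα] at h'
  nlinarith

end ValueQueryMechanism

/-! ### Choice of parameters -/

theorem eventually_growth {ε : ℝ} (hε : 0 < ε) :
    ∀ᶠ m : ℕ in Filter.atTop, 238 * (m : ℝ) ^ 5 * (2 : ℝ) ^ ((m : ℝ) ^ ε) ≤
      (2 : ℝ) ^ ((m : ℝ) ^ (2 * ε) / 136) := by
  -- With y = m^ε and log m ≤ y/10, the exponent 8 + 10 log m + y is at most 3y, and 3y ≤ y²/136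
  -- once y ≥ 408 = 3 · 136.
  have h₁ : ∀ᶠ m : ℕ in Filter.atTop, (408 : ℝ) ≤ (m : ℝ) ^ ε :=
    ((tendsto_rpow_atTop hε).comp tendsto_natCast_atTop_atTop).eventually_ge_atTop 408
  have h₂ : ∀ᶠ m : ℕ in Filter.atTop, ‖Real.log (m : ℝ)‖ ≤ 1 / 10 * ‖(m : ℝ) ^ ε‖ :=
    tendsto_natCast_atTop_atTop.eventually
      ((isLittleO_log_rpow_atTop hε).bound (by norm_num : (0 : ℝ) < 1 / 10))
  filter_upwards [h₁, h₂, Filter.eventually_gt_atTop 0] with m h₁ h₂ hm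
  have hm' : (0 : ℝ) < m := by exact_mod_cast hm
  have h1m : (1 : ℝ) ≤ m := by exact_mod_cast hm
  rw [Real.norm_of_nonneg (Real.log_nonneg h1m), Real.norm_of_nonneg (by positivity)] at h₂
  have hy : (m : ℝ) ^ (2 * ε) = (m : ℝ) ^ ε * (m : ℝ) ^ ε := by
    rw [← Real.rpow_add hm']; congr 1; ring
  set y := (m : ℝ) ^ ε
  have hpow : (m : ℝ) ≤ (2 : ℝ) ^ (2 * Real.log m) := by
    rw [Real.rpow_def_of_pos (by norm_num)]
    nth_rw 1 [← Real.exp_log hm']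
    rw [Real.exp_le_exp]
    nlinarith [Real.log_two_gt_d9, Real.log_nonneg h1m]
  have hpow5 : (m : ℝ) ^ 5 ≤ (2 : ℝ) ^ (10 * Real.log m) := by
    calc (m : ℝ) ^ 5 ≤ ((2 : ℝ) ^ (2 * Real.log m)) ^ 5 := by gcongr
      _ = _ := by rw [← Real.rpow_mul_natCast (by norm_num)]; congr 1; push_cast; ring
  calc 238 * (m : ℝ) ^ 5 * (2 : ℝ) ^ y
      ≤ (2 : ℝ) ^ (8 : ℝ) * (2 : ℝ) ^ (10 * Real.log m) * (2 : ℝ) ^ y := by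
        gcongr; norm_num
    _ = (2 : ℝ) ^ (8 + 10 * Real.log m + y) := by
        rw [Real.rpow_add (by norm_num), Real.rpow_add (by norm_num)]
    _ ≤ _ := by
        refine Real.rpow_le_rpow_of_exponent_le (by norm_num) ?_
        rw [hy]
        nlinarith

end CombAuction

theorem mainTheorem10 (ε : ℝ) (hε : 0 < ε) :
    ∃ C : ℝ, 0 < C ∧ ∃ m₀ : ℕ, ∀ m : ℕ, m₀ ≤ m → ∀ n : ℕ,
      C * (m : ℝ) ^ (1 / 2 - ε : ℝ) ≤ (n : ℝ) →
      ∀ M : CombAuction.ValueQueryMechanism n m,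
        M.IsTruthful (CombAuction.Submodular m) →
        M.HasApproxRatio (CombAuction.Submodular m) ((m : ℝ) ^ (1 / 2 - ε : ℝ)) →
        ∃ v : Fin n → CombAuction.BundleFun m, (∀ i, v i ∈ CombAuction.Submodular m) ∧
          (2 : ℝ) ^ ((m : ℝ) ^ ε) - 1 ≤ (M.numQueries v : ℝ) := by
  obtain ⟨m₁, hm₁⟩ := Filter.eventually_atTop.1 (CombAuction.eventually_growth hε)
  -- 16 makes k = ⌈16α⌉ at most n; 65 makes √m > 8, so that m/(8α) > 1.
  refine ⟨16, by norm_num, max m₁ 65, fun m hm n hn M hM happ => ?_⟩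
  by_contra! hcon
  have hgrow := hm₁ m ((le_max_left _ _).trans hm)
  have h65 : 65 ≤ m := (le_max_right _ _).trans hm
  have h65' : (65 : ℝ) ≤ m := by exact_mod_cast h65
  have hm0 : (0 : ℝ) < m := by linarith
  set α : ℝ := (m : ℝ) ^ (1 / 2 - ε : ℝ) with hαdef
  have hα0 : 0 < α := by positivity
  have hn0 : 0 < n := by
    have : (0 : ℝ) < n := lt_of_lt_of_le (by positivity) hn
    exact_mod_cast this
  have hα1 : 1 ≤ α := happ.one_le hα0 (by omega) hn0
  have hsq : √(m : ℝ) * √(m : ℝ) = m := Real.mul_self_sqrt hm0.le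
  have hα2 : α ≤ √(m : ℝ) := by
    rw [Real.sqrt_eq_rpow]
    exact Real.rpow_le_rpow_of_exponent_le (by linarith) (by linarith)
  have hsqrt : 8 < √(m : ℝ) := by
    rw [Real.lt_sqrt (by norm_num)]; linarith
  set k : ℕ := ⌈16 * α⌉₊ with hk
  have hk16 : 16 * α ≤ k := Nat.le_ceil _
  have hk17 : (k : ℝ) ≤ 17 * α := by
    have := Nat.ceil_lt_add_one (a := 16 * α) (by positivity)
    rw [← hk] at this
    linarith
  have hkpos : (0 : ℝ) < k := by linarith
  have : NeZero k := ⟨by rintro h; rw [h] at hkpos; simp at hkpos⟩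
  have hkn : k ≤ n := Nat.ceil_le.2 hn
  obtain ⟨I, -, hI⟩ := Finset.exists_subset_card_eq
    (s := (Finset.univ : Finset (Fin n))) (n := k) (by simpa using hkn)
  have hL : ∀ v : Fin n → CombAuction.BundleFun m, (∀ j, v j ∈ CombAuction.Submodular m) →
      M.numQueries v + 1 ≤ ⌊(2 : ℝ) ^ ((m : ℝ) ^ ε)⌋₊ := by
    intro v hv
    refine Nat.le_floor ?_
    push_cast
    linarith [hcon v hv]
  have hh : (m : ℝ) ^ (2 * ε) * α ^ 2 = m := by
    rw [hαdef, ← Real.rpow_mul_natCast hm0.le, ← Real.rpow_add hm0]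
    have : 2 * ε + (1 / 2 - ε) * ((2 : ℕ) : ℝ) = 1 := by push_cast; ring
    rw [this, Real.rpow_one]
  -- As k ≤ 17α and 136 = 8 · 17, this h gives kh ≤ m/(8α). Each of the four terms on the right is
  -- then at most a quarter of m/(2α), the last two strictly less.
  have htr := hM.tradeoff hα0 happ (by omega) hI hL
    (h := (m : ℝ) ^ (2 * ε) / 136) (by positivity)
  have hLle : ((⌊(2 : ℝ) ^ ((m : ℝ) ^ ε)⌋₊ : ℕ) : ℝ) ≤ (2 : ℝ) ^ ((m : ℝ) ^ ε) :=
    Nat.floor_le (by positivity)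
  have hα_le : α ≤ m := by nlinarith
  have h₁ : k * ((m : ℝ) ^ (2 * ε) / 136) ≤ m / (8 * α) := by
    rw [le_div_iff₀ (by positivity)]
    calc k * ((m : ℝ) ^ (2 * ε) / 136) * (8 * α)
        ≤ 17 * α * ((m : ℝ) ^ (2 * ε) / 136) * (8 * α) := by gcongr
      _ = (m : ℝ) ^ (2 * ε) * α ^ 2 := by ring
      _ = m := hh
  have h₂ : 2 * (m : ℝ) / k ≤ m / (8 * α) := by
    rw [div_le_div_iff₀ hkpos (by positivity)]
    nlinarith
  have h₃ : m * (k * (14 * m ^ 3 * (⌊(2 : ℝ) ^ ((m : ℝ) ^ ε)⌋₊ : ℕ) *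
      (2 : ℝ) ^ (-((m : ℝ) ^ (2 * ε) / 136)))) ≤ 1 := by
    rw [Real.rpow_neg (by norm_num), ← div_eq_mul_inv, mul_div_assoc', mul_div_assoc',
      div_le_one (by positivity)]
    calc m * (k * (14 * m ^ 3 * (⌊(2 : ℝ) ^ ((m : ℝ) ^ ε)⌋₊ : ℕ) : ℝ))
        ≤ m * (17 * m * (14 * m ^ 3 * (2 : ℝ) ^ ((m : ℝ) ^ ε))) := by
          gcongr
          linarith
      _ = 238 * (m : ℝ) ^ 5 * (2 : ℝ) ^ ((m : ℝ) ^ ε) := by ring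
      _ ≤ _ := hgrow
  have h₄ : m / (2 * α) = 4 * (m / (8 * α)) := by field_simp; norm_num
  have h₅ : 1 < m / (8 * α) := by
    rw [lt_div_iff₀ (by positivity)]
    nlinarith
  linarith
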